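/- \textbf{Setting.} Let $\mathcal F$ be a signature with a set $\mathcal D\subseteq\mathcal F$ of defined symbols (the other symbols are constructors), and let $\mathcal V$ be a countably infinite set of variables. Extend $\mathcal F$ by a new symbol $f^\sharp$ of the same arity for each $f\in\mathcal D$, and by a compound symbol $c_n$ of arity $n$ for each $n\in\mathbb N$. For a term $t=f(t_1,\dots,t_n)$ over $\mathcal F$ with $f\in\mathcal D$ put $t^\sharp=f^\sharp(t_1,\dots,t_n)$; for all other terms put $t^\sharp=t$. Put $\mathrm{com}(t)=t$ and otherwise $\mathrm{com}(t_1,\dots,t_n)=c_n(t_1,\dots,t_n)$. In every rewrite rule the left-hand side is not a variable and contains all variables of the right-hand side; a TRS is a finite set of rewrite rules. A \emph{dependency pair} (DP) is a rewrite rule $l^\sharp\to\mathrm{com}(r_1^\sharp,\dots,r_n^\sharp)$ with terms $l,r_1,\dots,r_n$ over $\mathcal F$, where the root of $l$ is in $\mathcal D$. For a set $R^\sharp$ of DPs let $\mathrm{sep}(R^\sharp)$ be the set of all DPs $l^\sharp\to r_i^\sharp$ such that $l^\sharp\to\mathrm{com}(r_1^\sharp,\dots,r_n^\sharp)\in R^\sharp$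 and $1\le i\le n$. For TRSs $Q,R$ write $s\xrightarrow{Q}_R t$ if $s=C[l\sigma]$ and $t=C[r\sigma]$ for a context $C$, a substitution $\sigma$ and a rule $l\to r\in R$ such that all proper arguments of $l\sigma$ are normal forms of $Q$. A \emph{complexity problem} $\langle S/W,Q,T\rangle$ consists of TRSs $S$ (strict rules), $W$ (weak rules), $Q$ and a set $T$ of starting terms. Its complexity function maps $n$ to the maximal $k$ such that there is a sequence of $k$ steps of the relation $\xrightarrow{Q}_W^{*}\cdot\xrightarrow{Q}_S\cdot\xrightarrow{Q}_W^{*}$ that starts in a term $t\in T$ with at most $n$ symbols; it is undefined at $n$ if no maximum exists, and $0$ if there is no such $t$. For $h:\mathbb N\to\mathbb N$ we write $\vdash\langle S/W,Q,T\rangle:h$ if the complexity function is defined on all inputs and belongs to $O(h)$. A \emph{DP problem} is a complexity problem $\mathcal P^\sharp=\langle S^\sharp\cup S/W^\sharp\cup W,Q,T^\sharp\rangle$ where $S^\sharp,W^\sharp$ are finite sets of DPs, $S,W$ are TRSs over $\mathcal F$, $Q$ is a TRS, and all elements of $T^\sharp$ have the form $f^\sharp(s_1,\dots,s_n)$ with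 $f\in\mathcal D$ and $s_1,\dots,s_n$ built from variables and constructors only. Its \emph{dependency graph} $\mathcal G$ has the nodes $S^\sharp\cup W^\sharp$ and an arrow from $s^\sharp\to\mathrm{com}(t_1^\sharp,\dots,t_n^\sharp)$ to $u^\sharp\to\mathrm{com}(v_1^\sharp,\dots,v_m^\sharp)$ if $t_i^\sharp\sigma\xrightarrow{Q}_{S\cup W}^{*}u^\sharp\tau$ for some $i$ and some substitutions $\sigma,\tau$ from $\mathcal V$ to the terms over $\mathcal F$. Write $\mathrm{Pre}_{\mathcal G}(R^\sharp)$ for the set of direct predecessors in $\mathcal G$ of elements of $R^\sharp$. \textbf{Theorem (Dependency Graph Decomposition).} Let $\mathcal P^\sharp=\langle S^\sharp\cup S/W^\sharp\cup W,Q,T^\sharp\rangle$ be a DP problem with dependency graph $\mathcal G$. Let $S^\sharp=S^\sharp_\downarrow\cup S^\sharp_\uparrow$ and $W^\sharp=W^\sharp_\downarrow\cup W^\sharp_\uparrow$ be partitions into disjoint sets, where also $S^\sharp_\uparrow\cap W^\sharp_\downarrow=\varnothing$, such that $S^\sharp_\downarrow\cup W^\sharp_\downarrow$ is closed under $\mathcal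 G$-successors and every predecessor of it outside of it is strict and upper: $$\mathrm{Pre}_{\mathcal G}(S^\sharp_\downarrow\cup W^\sharp_\downarrow)\setminus(S^\sharp_\downarrow\cup W^\sharp_\downarrow)\subseteq S^\sharp_\uparrow .$$ Let $f,g:\mathbb N\to\mathbb N$ satisfy $f(n)\ge1$ and $g(n)\ge1$ for all sufficiently large $n$. If $$\vdash\langle S^\sharp_\uparrow\cup S/W^\sharp_\uparrow\cup W,Q,T^\sharp\rangle:f\quad\text{and}\quad\vdash\langle S^\sharp_\downarrow\cup S/W^\sharp_\downarrow\cup\mathrm{sep}(S^\sharp_\uparrow\cup W^\sharp_\uparrow)\cup W,Q,T^\sharp\rangle:g,$$ then $\vdash\mathcal P^\sharp:f\cdot g$. -/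

import Mathlib

namespace CombFramework

universe u v

/-- The algebraic signature with `n`-ary function symbols `F n`, as a first-order language without
relation symbols. -/
abbrev Sig (F : ℕ → Type u) : FirstOrder.Language.{u, 0} := ⟨F, fun _ => Empty⟩

/-- Terms over the signature `F` and the variables `V`. -/
abbrev Tm (F : ℕ → Type u) (V : Type v) : Type (max v u) := (Sig F).Term V

section Rewriting

variable {F : ℕ → Type u} {V : Type v}

/-- The size of a term: the number of occurrences of variables and function symbols. -/
def size : Tm F V → ℕ
  | .var _ => 1
  | .func _ ts => 1 + ∑ i, size (ts i)

open Classical in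
/-- The set of variables of a term. -/
noncomputable def vars (t : Tm F V) : Set V := (t.varFinset : Set V)

/-- A pair of terms `lhs → rhs`. -/
structure Rule (F : ℕ → Type u) (V : Type v) where
  lhs : Tm F V
  rhs : Tm F V

/-- The usual restrictions on rewrite rules: the left-hand side is not a variable, and it contains
all variables of the right-hand side. -/
def Rule.IsRewriteRule (ρ : Rule F V) : Prop :=
  (∀ x : V, ρ.lhs ≠ .var x) ∧ vars ρ.rhs ⊆ vars ρ.lhs

/-- A set of rules is a (finite) term rewrite system. -/
def IsTRS (R : Set (Rule F V)) : Prop :=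
  R.Finite ∧ ∀ ρ ∈ R, ρ.IsRewriteRule

/-- One rewrite step with a rule of `R`, at any position, such that all arguments of the contracted
redex satisfy `N`. The closure under contexts is generated one argument position at a time. -/
inductive Step (N : Tm F V → Prop) (R : Set (Rule F V)) : Tm F V → Tm F V → Prop
  | root {n : ℕ} (f : F n) (ls : Fin n → Tm F V) (r : Tm F V) (σ : V → Tm F V)
      (hρ : (⟨.func f ls, r⟩ : Rule F V) ∈ R) (hN : ∀ i, N ((ls i).subst σ)) :
      Step N R (FirstOrder.Language.Term.subst (.func f ls) σ) (r.subst σ)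
  | arg {n : ℕ} (f : F n) (ts : Fin n → Tm F V) (i : Fin n) (t' : Tm F V)
      (h : Step N R (ts i) t') :
      Step N R (.func f ts) (.func f (Function.update ts i t'))

/-- Normal forms of `Q` (with respect to unrestricted rewriting). -/
def NF (Q : Set (Rule F V)) (t : Tm F V) : Prop :=
  ∀ u, ¬ Step (fun _ => True) Q t u

/-- The `Q`-restricted rewrite relation of `R`: arguments of the redex are `Q` normal forms. -/
def QRew (Q R : Set (Rule F V)) : Tm F V → Tm F V → Prop :=
  Step (NF Q) R

/-- The `Q`-restricted rewrite relation of `S` relative to `W`: one `S` step, preceded and followed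
by arbitrarily many `W` steps. -/
def RelRew (Q S W : Set (Rule F V)) (s t : Tm F V) : Prop :=
  ∃ s' t', Relation.ReflTransGen (QRew Q W) s s' ∧ QRew Q S s' t' ∧
    Relation.ReflTransGen (QRew Q W) t' t

/-- The derivation height of `t`: the supremum of the lengths of the finite derivations
`t → t₁ → ⋯ → tₙ`. The value `⊤` means that the maximum does not exist, i.e. that the
derivation height is undefined. -/
noncomputable def dheight (r : Tm F V → Tm F V → Prop) (t : Tm F V) : ℕ∞ :=
  ⨆ n ∈ {n : ℕ | ∃ c : ℕ → Tm F V, c 0 = t ∧ ∀ i < n, r (c i) (c (i + 1))}, (n : ℕ∞)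

/-- A complexity problem: strict rules, weak rules, the system `Q` that restricts the
strategy, and a set of starting terms. -/
structure Problem (F : ℕ → Type u) (V : Type v) where
  strict : Set (Rule F V)
  weak : Set (Rule F V)
  Q : Set (Rule F V)
  start : Set (Tm F V)

/-- The complexity function of a problem; the value `⊤` means undefined (and the maximum of
the empty set is `0`). -/
noncomputable def Problem.complexity (P : Problem F V) (n : ℕ) : ℕ∞ :=
  ⨆ t ∈ {t : Tm F V | t ∈ P.start ∧ size t ≤ n}, dheight (RelRew P.Q P.strict P.weak) t

/-- Validity of the judgement `⊢ P : f`: the complexity function of `P` is defined on all inputs,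
and it is in `O(f)`. -/
def Problem.Valid (P : Problem F V) (f : ℕ → ℕ) : Prop :=
  (∀ n, P.complexity n ≠ ⊤) ∧
    (fun n => ((P.complexity n).toNat : ℝ)) =O[Filter.atTop] (fun n => (f n : ℝ))

end Rewriting

/-- The extension of the signature `F`, with defined symbols `D`, by a dependency pair symbol `f♯`
for each defined symbol `f` and by one compound symbol of each arity. -/
inductive DPSym (F : ℕ → Type u) (D : ∀ n, Set (F n)) : ℕ → Type u
  | base {n : ℕ} (f : F n) : DPSym F D n
  | marked {n : ℕ} (f : F n) (hf : f ∈ D n) : DPSym F D n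
  | compound (n : ℕ) : DPSym F D n

section DependencyPairs

variable {F : ℕ → Type u} {V : Type v} (D : ∀ n, Set (F n))

/-- Terms over `F` as terms over the extended signature. -/
def embed : Tm F V → Tm (DPSym F D) V
  | .var x => .var x
  | .func f ts => .func (DPSym.base f) (fun i => embed (ts i))

/-- Rules over `F` as rules over the extended signature. -/
def embedTRS (R : Set (Rule F V)) : Set (Rule (DPSym F D) V) :=
  (fun ρ => ⟨embed D ρ.lhs, embed D ρ.rhs⟩) '' R

open Classical in
/-- `mark D t` is `t♯`: a defined root symbol `f` is replaced by `f♯`, and other terms do not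
change. -/
noncomputable def mark : Tm F V → Tm (DPSym F D) V
  | .var x => .var x
  | @FirstOrder.Language.Term.func _ _ n f ts =>
      if hf : f ∈ D n then .func (DPSym.marked f hf) (fun i => embed D (ts i))
      else .func (DPSym.base f) (fun i => embed D (ts i))

variable {D}

/-- `com [t] = t`, and otherwise `com [t₁, …, tₙ] = cₙ(t₁, …, tₙ)` for the `n`-ary compound
symbol `cₙ`. -/
def com : List (Tm (DPSym F D) V) → Tm (DPSym F D) V
  | [t] => t
  | ts => .func (DPSym.compound ts.length) ts.get

variable (D)

/-- The rule `l♯ → com(r₁♯, …, rₙ♯)`. Since no `rᵢ♯` contains a compound symbol, `l` and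
the list of the `rᵢ` are determined by this rule. -/
noncomputable def dpRule (l : Tm F V) (rs : List (Tm F V)) : Rule (DPSym F D) V :=
  ⟨mark D l, com (rs.map (mark D))⟩

/-- The root symbol of `t` is defined. -/
def HasDefinedRoot (t : Tm F V) : Prop :=
  ∃ (n : ℕ) (f : F n) (ts : Fin n → Tm F V), f ∈ D n ∧ t = .func f ts

/-- Terms built from variables and constructors, i.e. without defined symbols. -/
def IsConstructorTerm : Tm F V → Prop
  | .var _ => True
  | @FirstOrder.Language.Term.func _ _ n f ts => f ∉ D n ∧ ∀ i, IsConstructorTerm (ts i)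

/-- Basic terms: a defined symbol applied to constructor terms. -/
def IsBasic (t : Tm F V) : Prop :=
  ∃ (n : ℕ) (f : F n) (ts : Fin n → Tm F V),
    f ∈ D n ∧ (∀ i, IsConstructorTerm D (ts i)) ∧ t = .func f ts

variable {D}

/-- Dependency pairs: rewrite rules `l♯ → com(r₁♯, …, rₙ♯)` with `l, r₁, …, rₙ` over `F`, where
the root of `l` is defined (so that `l♯` is a marked term). -/
def IsDP (ρ : Rule (DPSym F D) V) : Prop :=
  ρ.IsRewriteRule ∧ ∃ l rs, HasDefinedRoot D l ∧ ρ = dpRule D l rs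

/-- `sep R` consists of the dependency pairs `l♯ → rᵢ♯` for `l♯ → com(r₁♯, …, rₙ♯)` in `R`. -/
def sep (R : Set (Rule (DPSym F D) V)) : Set (Rule (DPSym F D) V) :=
  {ρ | ∃ l rs r, dpRule D l rs ∈ R ∧ r ∈ rs ∧ ρ = dpRule D l [r]}

end DependencyPairs

/-- A dependency pair complexity problem `⟨S♯ ∪ S / W♯ ∪ W, Q, T♯⟩`: finite sets `S♯`, `W♯` of
dependency pairs, finite term rewrite systems `S`, `W` over `F`, a finite term rewrite system `Q`,
and a set of marked basic starting terms. -/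
structure DPProblem (F : ℕ → Type u) (D : ∀ n, Set (F n)) (V : Type v) where
  strictDP : Set (Rule (DPSym F D) V)
  weakDP : Set (Rule (DPSym F D) V)
  strictTRS : Set (Rule F V)
  weakTRS : Set (Rule F V)
  Q : Set (Rule (DPSym F D) V)
  start : Set (Tm (DPSym F D) V)
  strictDP_finite : strictDP.Finite
  weakDP_finite : weakDP.Finite
  isDP_strict : ∀ ρ ∈ strictDP, IsDP ρ
  isDP_weak : ∀ ρ ∈ weakDP, IsDP ρ
  isTRS_strict : IsTRS strictTRS
  isTRS_weak : IsTRS weakTRS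
  isTRS_Q : IsTRS Q
  start_basic : ∀ t ∈ start, ∃ s : Tm F V, IsBasic D s ∧ t = mark D s

namespace DPProblem

variable {F : ℕ → Type u} {D : ∀ n, Set (F n)} {V : Type v}

/-- The complexity problem with strict rules `A ∪ S` and weak rules `B ∪ W`, where `S`, `W`, `Q`
and the starting terms are those of the given DP problem. -/
def withPairs (P : DPProblem F D V) (A B : Set (Rule (DPSym F D) V)) :
    Problem (DPSym F D) V where
  strict := A ∪ embedTRS D P.strictTRS
  weak := B ∪ embedTRS D P.weakTRS
  Q := P.Q
  start := P.start

/-- The underlying complexity problem. -/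
def toProblem (P : DPProblem F D V) : Problem (DPSym F D) V :=
  P.withPairs P.strictDP P.weakDP

/-- The arrows of the dependency graph (without their labels): from `s♯ → com(t₁♯, …, tₙ♯)` to
`u♯ → com(v₁♯, …, vₘ♯)` if, for some `i` and substitutions `σ`, `τ` into terms over `F`, the term
`tᵢ♯σ` rewrites in finitely many `S ∪ W` steps to `u♯τ`. -/
def DGArrow (P : DPProblem F D V) (ρ ρ' : Rule (DPSym F D) V) : Prop :=
  ρ ∈ P.strictDP ∪ P.weakDP ∧ ρ' ∈ P.strictDP ∪ P.weakDP ∧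
    ∃ s ts t, ρ = dpRule D s ts ∧ t ∈ ts ∧
      ∃ σ τ : V → Tm F V,
        Relation.ReflTransGen (QRew P.Q (embedTRS D (P.strictTRS ∪ P.weakTRS)))
          ((mark D t).subst (fun x => embed D (σ x)))
          (ρ'.lhs.subst (fun x => embed D (τ x)))

/-- A set of dependency pairs is closed under successors in the dependency graph. -/
def ClosedUnderSucc (P : DPProblem F D V) (R : Set (Rule (DPSym F D) V)) : Prop :=
  ∀ ρ ∈ R, ∀ ρ', P.DGArrow ρ ρ' → ρ' ∈ R

/-- The direct predecessors, in the dependency graph, of the elements of `R`. -/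
def Pre (P : DPProblem F D V) (R : Set (Rule (DPSym F D) V)) : Set (Rule (DPSym F D) V) :=
  {ρ | ∃ ρ' ∈ R, P.DGArrow ρ ρ'}

end DPProblem

end CombFramework

open CombFramework

namespace CombFramework

universe u v

/-! ### Derivations with counted steps -/

section Derivations

variable {F : ℕ → Type u} {V : Type v} {N : Tm F V → Prop} {A B A' : Set (Rule F V)}

/-! A derivation from a marked basic term is a tree. A leaf is a term over `F` with a possibly
marked root. It rewrites by rules over `F` and remains a leaf, or a pair contracts its root and it
becomes `com` of new leaves (`Leaf.step`). Compound symbols are never rewritten, so these new leaves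
evolve independently (`Der.split_com`) and their derivations can be recombined (`Run.com`).

Cut each branch just before its first lower pair. What remains is a derivation of the upper problem,
with `a` counted steps, say. Each part cut off uses only lower pairs, because these are closed under
successors (`run_of_reaches_closed`). Preceded by the path from the starting term to its leaf, it is
a derivation of the lower problem: where the path meets an upper pair, the `sep` pair selects the
one child that is followed. So the part has at most `b` counted steps, where `b` is the complexity
of the lower problem.

The last pair before a cut, if there is one, precedes a lower pair in the graph, so it is strict and
upper. It was thus counted in the upper derivation. If `K` bounds the number of children of strict
upper pairs, there are at most `K * a + 1` cuts; the `1` is for a branch that begins with a lower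
pair. The total is at most `a + (K * a + 1) * b` (`exists_upper_run`), which is in `O(f * g)`. -/

theorem Step.mono (hA : A ⊆ A') {s t : Tm F V} (h : Step N A s t) : Step N A' s t := by
  induction h with
  | root f ls r σ hρ hN => exact .root f ls r σ (hA hρ) hN
  | arg f ts i t' _ ih => exact .arg f ts i t' ih

theorem step_union {s t : Tm F V} (h : Step N (A ∪ B) s t) : Step N A s t ∨ Step N B s t := by
  induction h with
  | root f ls r σ hρ hN => exact hρ.imp (.root f ls r σ · hN) (.root f ls r σ · hN)
  | arg f ts i t' _ ih => exact ih.imp (.arg f ts i t') (.arg f ts i t')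

/-- With source and target given by equations, a step from a concrete term can be analysed by
comparing root symbols. -/
theorem Step.inv {s u : Tm F V} (h : Step N A s u) :
    (∃ (n : ℕ) (f : F n) (ls : Fin n → Tm F V) (r : Tm F V) (σ : V → Tm F V),
      (⟨.func f ls, r⟩ : Rule F V) ∈ A ∧ (∀ i, N ((ls i).subst σ)) ∧
      s = .func f (fun i => (ls i).subst σ) ∧ u = r.subst σ) ∨
    ∃ (n : ℕ) (f : F n) (ts : Fin n → Tm F V) (i : Fin n) (t' : Tm F V),
      Step N A (ts i) t' ∧ s = .func f ts ∧ u = .func f (Function.update ts i t') := by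
  cases h with
  | root f ls r σ hρ hN => exact .inl ⟨_, f, ls, r, σ, hρ, hN, rfl, rfl⟩
  | arg f ts i t' h => exact .inr ⟨_, f, ts, i, t', h, rfl, rfl⟩

/-- `Der N A B l k s t`: there is a derivation of length `l` from `s` to `t` with `k` steps counted
as `A` steps; the other steps are `B` steps or uncounted `A` steps. -/
inductive Der (N : Tm F V → Prop) (A B : Set (Rule F V)) : ℕ → ℕ → Tm F V → Tm F V → Prop
  | refl (s : Tm F V) : Der N A B 0 0 s s
  | strict {l k : ℕ} {s t u : Tm F V} (h : Step N A s t) (hd : Der N A B l k t u) :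
      Der N A B (l + 1) (k + 1) s u
  | weak {l k : ℕ} {s t u : Tm F V} (h : Step N (A ∪ B) s t) (hd : Der N A B l k t u) :
      Der N A B (l + 1) k s u

/-- Some finite derivation from `s` has `k` counted `A` steps. -/
def Run (N : Tm F V → Prop) (A B : Set (Rule F V)) (k : ℕ) (s : Tm F V) : Prop :=
  ∃ l t, Der N A B l k s t

theorem Der.trans {l k l' k' : ℕ} {s t u : Tm F V} (h : Der N A B l k s t)
    (h' : Der N A B l' k' t u) : Der N A B (l + l') (k + k') s u := by
  induction h with
  | refl s => simpa using h'
  | strict h _ ih => rw [Nat.add_right_comm, Nat.add_right_comm _ 1]; exact .strict h (ih h')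
  | weak h _ ih => rw [Nat.add_right_comm]; exact .weak h (ih h')

theorem Der.arg {n : ℕ} (f : F n) (ts : Fin n → Tm F V) (i : Fin n) {l k : ℕ} {s t : Tm F V}
    (h : Der N A B l k s t) :
    Der N A B l k (.func f (Function.update ts i s)) (.func f (Function.update ts i t)) := by
  have lift : ∀ {C : Set (Rule F V)} {s t : Tm F V}, Step N C s t →
      Step N C (.func f (Function.update ts i s)) (.func f (Function.update ts i t)) := by
    intro C s t h
    have := Step.arg (N := N) (R := C) f (Function.update ts i s) i t (by simpa using h)
    simpa using this
  induction h with
  | refl s => exact .refl _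
  | strict h _ ih => exact .strict (lift h) ih
  | weak h _ ih => exact .weak (lift h) ih

theorem Run.zero (s : Tm F V) : Run N A B 0 s := ⟨0, s, .refl s⟩

theorem Run.strict {k : ℕ} {s t : Tm F V} (h : Step N A s t) (hr : Run N A B k t) :
    Run N A B (k + 1) s :=
  let ⟨_, _, hd⟩ := hr; ⟨_, _, .strict h hd⟩

theorem Run.weak {k : ℕ} {s t : Tm F V} (h : Step N (A ∪ B) s t) (hr : Run N A B k t) :
    Run N A B k s :=
  let ⟨_, _, hd⟩ := hr; ⟨_, _, .weak h hd⟩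

/-- The arguments are rewritten one after the other; `key` treats the state in which those in `I`
are finished. -/
theorem Run.func {n : ℕ} (f : F n) (ts : Fin n → Tm F V) (k : Fin n → ℕ)
    (h : ∀ i, Run N A B (k i) (ts i)) : Run N A B (∑ i, k i) (.func f ts) := by
  choose l ts' hd using h
  have key : ∀ I : Finset (Fin n), ∃ l', Der N A B l' (∑ i ∈ I, k i) (.func f ts)
      (.func f (fun i => if i ∈ I then ts' i else ts i)) := by
    intro I
    induction I using Finset.induction_on with
    | empty => exact ⟨0, by simpa using Der.refl _⟩
    | insert a I ha ih =>
      obtain ⟨l', hl⟩ := ih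
      have h1 := (hd a).arg f (fun i => if i ∈ I then ts' i else ts i) a
      have e1 : Function.update (fun i => if i ∈ I then ts' i else ts i) a (ts a)
          = fun i => if i ∈ I then ts' i else ts i := by
        rw [Function.update_eq_self_iff]; simp [ha]
      have e2 : Function.update (fun i => if i ∈ I then ts' i else ts i) a (ts' a)
          = fun i => if i ∈ insert a I then ts' i else ts i := by
        funext i
        by_cases hi : i = a
        · subst hi; simp
        · simp [hi]
      rw [e1, e2] at h1
      refine ⟨l' + l a, ?_⟩
      rw [Finset.sum_insert ha, add_comm (k a)]
      exact hl.trans h1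
  obtain ⟨l', h'⟩ := key Finset.univ
  exact ⟨_, _, h'⟩

/-- A derivation from a term whose root symbol is not the root of a left-hand side splits into
derivations from its arguments. -/
theorem Der.split {n : ℕ} {f : F n}
    (hf : ∀ (ls : Fin n → Tm F V) (r : Tm F V), (⟨.func f ls, r⟩ : Rule F V) ∉ A ∪ B)
    {l k : ℕ} {s u : Tm F V} (h : Der N A B l k s u) (ts : Fin n → Tm F V)
    (hs : s = .func f ts) :
    ∃ k' : Fin n → ℕ, k = ∑ i, k' i ∧ ∀ i, ∃ l' ≤ l, ∃ u', Der N A B l' (k' i) (ts i) u' := by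
  have inv : ∀ {C : Set (Rule F V)} (_ : C ⊆ A ∪ B) {ts : Fin n → Tm F V} {u : Tm F V},
      Step N C (.func f ts) u →
      ∃ i t', Step N C (ts i) t' ∧ u = .func f (Function.update ts i t') := by
    intro C hC ts u h
    rcases h.inv with ⟨m, g, ls, r, σ, hρ, -, hs, -⟩ | ⟨m, g, ts', i, t', ht, hs, rfl⟩
    · cases hs
      exact absurd (hC hρ) (hf _ _)
    · cases hs
      exact ⟨i, t', ht, rfl⟩
  induction h generalizing ts with
  | refl s => exact ⟨0, by simp, fun i => ⟨0, le_rfl, _, .refl _⟩⟩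
  | @strict l k s t u h _ ih =>
    subst hs
    obtain ⟨i, t', ht, rfl⟩ := inv Set.subset_union_left h
    obtain ⟨k', rfl, hk⟩ := ih _ rfl
    -- The counted step is credited to the argument `i` in which it takes place.
    refine ⟨Function.update k' i (k' i + 1), ?_, fun j => ?_⟩
    · rw [Finset.sum_update_of_mem (Finset.mem_univ i), add_right_comm,
        ← Finset.sum_eq_add_sum_sdiff_singleton_of_mem (Finset.mem_univ i)]
    · obtain ⟨l', hl, u', hd⟩ := hk j
      by_cases hj : j = i
      · subst hj
        simp only [Function.update_self] at hd ⊢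
        exact ⟨l' + 1, by omega, u', .strict ht hd⟩
      · simp only [Function.update_of_ne hj] at hd ⊢
        exact ⟨l', by omega, u', hd⟩
  | @weak l k s t u h _ ih =>
    subst hs
    obtain ⟨i, t', ht, rfl⟩ := inv subset_rfl h
    obtain ⟨k', rfl, hk⟩ := ih _ rfl
    refine ⟨k', rfl, fun j => ?_⟩
    obtain ⟨l', hl, u', hd⟩ := hk j
    by_cases hj : j = i
    · subst hj
      simp only [Function.update_self] at hd
      exact ⟨l' + 1, by omega, u', .weak ht hd⟩
    · simp only [Function.update_of_ne hj] at hd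
      exact ⟨l', by omega, u', hd⟩

theorem Run.of_reflTransGen {k : ℕ} {s t : Tm F V}
    (h : Relation.ReflTransGen (Step N (A ∪ B)) s t) (hr : Run N A B k t) : Run N A B k s := by
  induction h using Relation.ReflTransGen.head_induction_on with
  | refl => exact hr
  | head h _ ih => exact .weak h ih

variable {Q : Set (Rule F V)}

theorem run_of_chain {n : ℕ} {c : ℕ → Tm F V} (h : ∀ i < n, RelRew Q A B (c i) (c (i + 1))) :
    Run (NF Q) A B n (c 0) := by
  induction n generalizing c with
  | zero => exact .zero _
  | succ n ih =>
    obtain ⟨s', t', h1, h2, h3⟩ := h 0 n.succ_pos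
    have hB := fun s t => Step.mono (N := NF Q) (Set.subset_union_right (s := A) (t := B)) (s := s) (t := t)
    exact .of_reflTransGen (Relation.ReflTransGen.mono hB _ _ h1) <| .strict h2 <| .of_reflTransGen (Relation.ReflTransGen.mono hB _ _ h3) <|
      ih (c := fun i => c (i + 1)) fun i hi => h (i + 1) (by omega)

theorem Run.exists_chain {k : ℕ} {s : Tm F V} (h : Run (NF Q) A B k s) :
    ∃ c : ℕ → Tm F V, c 0 = s ∧ ∀ i < k, RelRew Q A B (c i) (c (i + 1)) := by
  obtain ⟨l, t, h⟩ := h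
  have cons : ∀ {k : ℕ} {s t : Tm F V}, Step (NF Q) A s t →
      (∃ c : ℕ → Tm F V, c 0 = t ∧ ∀ i < k, RelRew Q A B (c i) (c (i + 1))) →
      ∃ c : ℕ → Tm F V, c 0 = s ∧ ∀ i < k + 1, RelRew Q A B (c i) (c (i + 1)) := by
    rintro k s t h ⟨c, rfl, hc⟩
    refine ⟨fun i => Nat.casesOn i s c, rfl, fun i hi => ?_⟩
    cases i with
    | zero => exact ⟨s, c 0, .refl, h, .refl⟩
    | succ i => exact hc i (by omega)
  induction h with
  | refl s => exact ⟨fun _ => s, rfl, by simp⟩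
  | strict h _ ih => exact cons h ih
  | @weak l k s t u h _ ih =>
    rcases step_union h with h | h
    -- An uncounted `A` step gives a chain that is one step too long; its last step is dropped.
    · obtain ⟨c, h0, hc⟩ := cons h ih
      exact ⟨c, h0, fun i hi => hc i (by omega)⟩
    · obtain ⟨c, rfl, hc⟩ := ih
      -- A `B` step is absorbed into the weak prefix of the first relative step.
      refine ⟨fun i => Nat.casesOn i s (fun j => c (j + 1)), rfl, fun i hi => ?_⟩
      cases i with
      | zero =>
        obtain ⟨s', t', h1, h2, h3⟩ := hc 0 hi
        exact ⟨s', t', .head h h1, h2, h3⟩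
      | succ i => exact hc (i + 1) hi

/-- Reduces complexity bounds to bounds on counted runs: the hypotheses of the theorem are read from
left to right, its conclusion from right to left. -/
theorem Problem.complexity_le_iff (P : Problem F V) (n : ℕ) (M : ℕ∞) :
    P.complexity n ≤ M ↔ ∀ t ∈ P.start, size t ≤ n → ∀ k : ℕ,
      Run (NF P.Q) P.strict P.weak k t → (k : ℕ∞) ≤ M := by
  simp only [Problem.complexity, dheight, iSup_le_iff, Set.mem_ofPred_eq]
  constructor
  · intro h t ht hn k hk
    exact h t ⟨ht, hn⟩ k hk.exists_chain
  · rintro h t ⟨ht, hn⟩ k ⟨c, rfl, hc⟩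
    exact h _ ht hn k (run_of_chain hc)

theorem vars_func {n : ℕ} (f : F n) (ts : Fin n → Tm F V) {x : V} :
    x ∈ vars (.func f ts : Tm F V) ↔ ∃ i, x ∈ vars (ts i) := by
  simp [vars, FirstOrder.Language.Term.varFinset]

theorem vars_var {x y : V} : x ∈ vars (.var y : Tm F V) ↔ x = y := by
  simp [vars, FirstOrder.Language.Term.varFinset]

theorem subst_congr {σ τ : V → Tm F V} (t : Tm F V) (h : ∀ x ∈ vars t, σ x = τ x) :
    t.subst σ = t.subst τ := by
  induction t with
  | var y => exact h y (vars_var.2 rfl)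
  | func f ts ih =>
    simp only [FirstOrder.Language.Term.subst]
    congr 1
    funext i
    exact ih i fun x hx => h x ((vars_func f ts).2 ⟨i, hx⟩)

end Derivations

/-! ### Terms over `F` with a possibly marked root, and their steps -/

section Leaves

variable {F : ℕ → Type u} {V : Type v} {D : ∀ n, Set (F n)}

theorem embed_subst (t : Tm F V) (τ : V → Tm F V) :
    (embed D t).subst (fun x => embed D (τ x)) = embed D (t.subst τ) := by
  induction t with
  | var x => rfl
  | func f ts ih =>
    simp only [embed, FirstOrder.Language.Term.subst]
    congr 1
    funext i
    exact ih i

theorem vars_embed (t : Tm F V) : vars (embed D t) = vars t := by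
  induction t with
  | var x => ext y; simp only [embed, vars_var]
  | func f ts ih => ext y; simp only [embed, vars_func, ih]

/-- Each `σ x` with `x` in `t` is a subterm of the instance, and subterms of embedded terms are
embedded. -/
theorem exists_embed_of_subst_eq {t t' : Tm F V} {σ : V → Tm (DPSym F D) V}
    (h : (embed D t).subst σ = embed D t') {x : V} (hx : x ∈ vars t) :
    ∃ r, σ x = embed D r := by
  induction t generalizing t' with
  | var y =>
    rw [vars_var] at hx
    subst hx
    exact ⟨t', h⟩
  | func f ts ih =>
    obtain ⟨i, hi⟩ := (vars_func f ts).1 hx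
    cases t' with
    | var y => simp [embed, FirstOrder.Language.Term.subst] at h
    | func g ts' =>
      simp only [embed, FirstOrder.Language.Term.subst] at h
      injection h with h1 h2 h3
      subst h1
      exact ih i (congrFun (eq_of_heq h3) i) hi

/-- A substitution that is a substitution of terms over `F` on the variables of `t` may be replaced
by such a substitution. -/
theorem exists_embed_subst (X : Set V) (σ : V → Tm (DPSym F D) V)
    (h : ∀ x ∈ X, ∃ r, σ x = embed D r) :
    ∃ τ : V → Tm F V, ∀ x ∈ X, σ x = embed D (τ x) := by
  classical
  refine ⟨fun x => if hx : ∃ r, σ x = embed D r then hx.choose else .var x, fun x hx => ?_⟩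
  simp only [dif_pos (h x hx)]
  exact (h x hx).choose_spec

variable (D) in
/-- Terms over `F`, possibly with a marked root symbol. -/
def Leaf (s : Tm (DPSym F D) V) : Prop :=
  (∃ t, s = embed D t) ∨ ∃ (n : ℕ) (f : F n) (hf : f ∈ D n) (ts : Fin n → Tm F V),
    s = .func (DPSym.marked f hf) (fun i => embed D (ts i))

theorem mark_of_mem {n : ℕ} {f : F n} (hf : f ∈ D n) (ts : Fin n → Tm F V) :
    mark D (.func f ts) = .func (DPSym.marked f hf) (fun i => embed D (ts i)) := by
  simp [mark, hf]

theorem mark_of_not_mem {n : ℕ} {f : F n} (hf : f ∉ D n) (ts : Fin n → Tm F V) :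
    mark D (.func f ts) = embed D (.func f ts) := by
  simp [mark, embed, hf]

theorem leaf_mark (t : Tm F V) : Leaf D (mark D t) := by
  cases t with
  | var x => exact .inl ⟨.var x, rfl⟩
  | @func n f ts =>
    by_cases hf : f ∈ D n
    · exact .inr ⟨n, f, hf, ts, mark_of_mem hf ts⟩
    · exact .inl ⟨_, mark_of_not_mem hf ts⟩

theorem Leaf.subst {s : Tm (DPSym F D) V} (hs : Leaf D s) (τ : V → Tm F V) :
    Leaf D (s.subst fun x => embed D (τ x)) := by
  rcases hs with ⟨t, rfl⟩ | ⟨n, f, hf, ts, rfl⟩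
  · exact .inl ⟨_, embed_subst t τ⟩
  · exact .inr ⟨n, f, hf, fun i => (ts i).subst τ, by
      simp only [FirstOrder.Language.Term.subst, embed_subst]⟩

theorem Leaf.ne_compound {s : Tm (DPSym F D) V} (hs : Leaf D s) {n : ℕ}
    (ts : Fin n → Tm (DPSym F D) V) : s ≠ .func (DPSym.compound n) ts := by
  rcases hs with ⟨t, rfl⟩ | ⟨m, f, hf, ts', rfl⟩
  · cases t with
    | var x => simp [embed]
    | func f ts' =>
      intro h
      simp only [embed] at h
      cases h
  · intro h
    cases h

theorem com_subst (cs : List (Tm (DPSym F D) V)) (σ : V → Tm (DPSym F D) V) :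
    (com cs).subst σ = com (cs.map (·.subst σ)) := by
  match cs with
  | [] =>
    simp only [com, List.map_nil, FirstOrder.Language.Term.subst]
    congr 1
    funext i
    exact i.elim0
  | [t] => rfl
  | t :: t' :: ts =>
    simp only [com, List.map_cons, FirstOrder.Language.Term.subst]
    have key : ∀ (l l' : List (Tm (DPSym F D) V)), l' = l.map (·.subst σ) →
        (FirstOrder.Language.Term.func (DPSym.compound l.length) (fun i => (l.get i).subst σ) :
          Tm (DPSym F D) V) = .func (DPSym.compound l'.length) l'.get := by
      rintro l l' rfl
      have hl : (l.map (·.subst σ)).length = l.length := List.length_map _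
      -- The length of the mapped list, on which the types depend, equals that of `l` only
      -- propositionally; a free `m` can be eliminated.
      have gen : ∀ (m : ℕ) (h : m = l.length) (g : Fin m → Tm (DPSym F D) V),
          (∀ i, g i = (l.get (Fin.cast h i)).subst σ) →
          (FirstOrder.Language.Term.func (DPSym.compound l.length) (fun i => (l.get i).subst σ) :
          Tm (DPSym F D) V) = .func (DPSym.compound m) g := by
        rintro m rfl g hg
        congr 1
        funext i
        exact (hg i).symm
      exact gen _ hl _ (by simp)
    exact key (t :: t' :: ts) _ rfl

variable {N : Tm (DPSym F D) V → Prop}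

/-- No pair applies inside a term over `F`, since its left-hand side has a marked root. The variable
condition on rules keeps the contractum over `F`. -/
theorem step_embed {C : Set (Rule (DPSym F D) V)} (hC : ∀ ρ ∈ C, IsDP ρ) {R : Set (Rule F V)}
    (hR : ∀ ρ ∈ R, ρ.IsRewriteRule) {t : Tm F V} {u : Tm (DPSym F D) V}
    (h : Step N (C ∪ embedTRS D R) (embed D t) u) :
    Step N (embedTRS D R) (embed D t) u ∧ ∃ t', u = embed D t' := by
  induction t generalizing u with
  | var x =>
    rcases h.inv with ⟨m, g, ls, r, σ, hρ, -, hs, -⟩ | ⟨m, g, ts', i, t', ht, hs, rfl⟩ <;>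
    simp [embed] at hs
  | @func n f ts ih =>
    rcases h.inv with ⟨m, g, ls, r, σ, hρ, hN, hs, rfl⟩ | ⟨m, g, ts', i, t', ht, hs, rfl⟩
    · rcases hρ with hρ | hρ
      · obtain ⟨-, l, rs, ⟨n', f', ts', hf', rfl⟩, he⟩ := hC _ hρ
        have hl := congrArg Rule.lhs he
        simp only [dpRule, mark_of_mem hf'] at hl
        cases hl
        simp only [embed] at hs
        cases hs
      · have hs' : (FirstOrder.Language.Term.func g ls : Tm (DPSym F D) V).subst σ
          = embed D (.func f ts) := hs.symm
        refine ⟨by rw [← hs']; exact .root g ls r σ hρ hN, ?_⟩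
        obtain ⟨⟨l, r'⟩, hmem, he⟩ := hρ
        obtain ⟨-, hv⟩ := hR _ hmem
        have hl := congrArg Rule.lhs he
        have hr := congrArg Rule.rhs he
        simp only at hl hr hv
        subst hr
        rw [← hl] at hs'
        obtain ⟨τ, hτ⟩ := exists_embed_subst (vars l) σ fun x => exists_embed_of_subst_eq hs'
        exact ⟨r'.subst τ, by
          rw [← embed_subst]
          exact subst_congr _ fun x hx => hτ x (hv (by rwa [vars_embed] at hx))⟩
    · simp only [embed] at hs
      cases hs
      obtain ⟨h1, t'', rfl⟩ := ih i ht
      refine ⟨.arg _ _ i _ h1, .func f (Function.update ts i t''), ?_⟩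
      simp only [embed]
      congr 1
      funext j
      by_cases hj : j = i
      · subst hj; simp
      · simp [hj]

/-- A step from a leaf is a step with a rule over `F` to a leaf, or a root step with a dependency
pair. -/
theorem Leaf.step {C : Set (Rule (DPSym F D) V)} (hC : ∀ ρ ∈ C, IsDP ρ) {R : Set (Rule F V)}
    (hR : ∀ ρ ∈ R, ρ.IsRewriteRule) {s u : Tm (DPSym F D) V} (hs : Leaf D s)
    (h : Step N (C ∪ embedTRS D R) s u) :
    (Step N (embedTRS D R) s u ∧ Leaf D u) ∨
    ∃ (l : Tm F V) (rs : List (Tm F V)) (τ : V → Tm F V), dpRule D l rs ∈ C ∧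
      s = (mark D l).subst (fun x => embed D (τ x)) ∧
      u = com (rs.map fun r => (mark D r).subst fun x => embed D (τ x)) ∧
      ∀ (rs' : List (Tm F V)) (A : Set (Rule (DPSym F D) V)), dpRule D l rs' ∈ A →
        Step N A s (com (rs'.map fun r => (mark D r).subst fun x => embed D (τ x))) := by
  rcases hs with ⟨t, rfl⟩ | ⟨n, f, hf, ts, rfl⟩
  · obtain ⟨h1, t', rfl⟩ := step_embed hC hR h
    exact .inl ⟨h1, .inl ⟨t', rfl⟩⟩
  rcases h.inv with ⟨m, g, ls, r, σ, hρ, hN, hs, rfl⟩ | ⟨m, g, ts', i, t', ht, hs, rfl⟩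
  · right
    rcases hρ with hρ | ⟨⟨l, r'⟩, hmem, he⟩
    · obtain ⟨⟨-, hv⟩, l, rs, ⟨n', f', ts', hf', rfl⟩, he⟩ := hC _ hρ
      have hl := congrArg Rule.lhs he
      have hr := congrArg Rule.rhs he
      simp only [dpRule] at hl hr hv
      subst hr
      have hs' : (mark D (.func f' ts')).subst σ =
          .func (DPSym.marked f hf) (fun i => embed D (ts i)) := by rw [← hl, hs]; rfl
      -- Arrows of the dependency graph require substitutions into terms over `F`, so `σ` is
      -- replaced by such a substitution.
      obtain ⟨τ, hτ⟩ := exists_embed_subst (vars (mark D (.func f' ts'))) σ fun x hx => by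
        rw [mark_of_mem hf', vars_func] at hx
        obtain ⟨i, hi⟩ := hx
        rw [vars_embed] at hi
        rw [mark_of_mem hf'] at hs'
        simp only [FirstOrder.Language.Term.subst] at hs'
        injection hs' with h1 h2 h3
        subst h1
        exact exists_embed_of_subst_eq (congrFun (eq_of_heq h3) i) hi
      have hτl : (mark D (.func f' ts')).subst σ = (mark D (.func f' ts')).subst
          (fun x => embed D (τ x)) := subst_congr _ hτ
      refine ⟨_, rs, τ, he ▸ hρ, by rw [← hs', hτl], ?_, fun rs' A hA => ?_⟩
      · rw [subst_congr _ fun x hx => hτ x (hl ▸ hv hx), com_subst, List.map_map]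
        rfl
      -- The strategy constrains only the arguments of the redex, so any pair with the same
      -- left-hand side, such as a `sep` pair, contracts it too.
      · have := com_subst (rs'.map (mark D)) (fun x => embed D (τ x))
        rw [List.map_map] at this
        rw [← hs', hτl, ← hl]
        simp only [dpRule] at hA
        rw [← hl] at hA hτl
        refine (this ▸ Step.root (N := N) (R := A) g ls _ (fun x => embed D (τ x)) hA
          fun i => ?_ :)
        rw [← subst_congr (ls i) fun x hx => hτ x (hl ▸ (vars_func g ls).2 ⟨i, hx⟩)]
        exact hN i
    -- A rule over `F` cannot apply at a marked root: its left-hand side is not a variable and has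
    -- an unmarked root.
    · obtain ⟨hnv, -⟩ := hR _ hmem
      have hl := congrArg Rule.lhs he
      cases l with
      | var x => exact absurd rfl (hnv x)
      | func f' ts' =>
        simp only [embed] at hl
        cases hl
        cases hs
  · left
    cases hs
    obtain ⟨h1, t'', rfl⟩ := step_embed hC hR ht
    refine ⟨.arg _ _ i _ h1, .inr ⟨_, f, hf, Function.update ts i t'', ?_⟩⟩
    congr 1
    funext j
    by_cases hj : j = i
    · subst hj; simp
    · simp [hj]

end Leaves

/-! ### Independence of the arguments of compound symbols -/

section Compound

variable {F : ℕ → Type u} {V : Type v} {D : ∀ n, Set (F n)} {N : Tm (DPSym F D) V → Prop}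
  {A B : Set (Rule (DPSym F D) V)}

theorem com_eq_func (cs : List (Tm (DPSym F D) V)) :
    (∃ c, cs = [c]) ∨ com cs = .func (DPSym.compound cs.length) cs.get := by
  match cs with
  | [] => exact .inr rfl
  | [c] => exact .inl ⟨c, rfl⟩
  | _ :: _ :: _ => exact .inr rfl

theorem Run.com (cs : List (Tm (DPSym F D) V)) (k : Fin cs.length → ℕ)
    (h : ∀ i, Run N A B (k i) (cs.get i)) : Run N A B (∑ i, k i) (com cs) := by
  rcases com_eq_func cs with ⟨c, rfl⟩ | hc
  · simpa [CombFramework.com] using h 0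
  · rw [hc]
    exact .func _ _ k h

/-- No left-hand side of a rule of `A` has a compound root symbol. -/
def CompoundFree (A : Set (Rule (DPSym F D) V)) : Prop :=
  ∀ (n : ℕ) (ls : Fin n → Tm (DPSym F D) V) (r : Tm (DPSym F D) V),
    (⟨.func (DPSym.compound n) ls, r⟩ : Rule (DPSym F D) V) ∉ A

/-- No rule applies at a compound root, and `com [c]` is `c` itself. The bound `l' ≤ l` supports
inductions on the derivation length. -/
theorem Der.split_com (hA : CompoundFree (A ∪ B)) {l k : ℕ} {cs : List (Tm (DPSym F D) V)}
    {u : Tm (DPSym F D) V} (h : Der N A B l k (com cs) u) :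
    ∃ k' : Fin cs.length → ℕ, k = ∑ i, k' i ∧
      ∀ i, ∃ l' ≤ l, ∃ u', Der N A B l' (k' i) (cs.get i) u' := by
  rcases com_eq_func cs with ⟨c, rfl⟩ | hc
  · exact ⟨fun _ => k, by simp, fun i => ⟨l, le_rfl, u, by simpa [CombFramework.com] using h⟩⟩
  · rw [hc] at h
    exact h.split (hA _) _ rfl

theorem compoundFree_union_embedTRS {C : Set (Rule (DPSym F D) V)} (hC : ∀ ρ ∈ C, IsDP ρ)
    (R : Set (Rule F V)) : CompoundFree (C ∪ embedTRS D R) := by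
  rintro n ls r (h | ⟨ρ, -, h⟩)
  · obtain ⟨-, l, rs, -, he⟩ := hC _ h
    exact (leaf_mark l).ne_compound ls (congrArg Rule.lhs he).symm
  · exact Leaf.ne_compound (.inl ⟨ρ.lhs, rfl⟩) ls (congrArg Rule.lhs h)

/-- The arity of a compound symbol, and `1` for the other symbols. -/
def DPSym.comArity : ∀ {n : ℕ}, DPSym F D n → ℕ
  | _, .compound n => n
  | _, _ => 1

/-- The number of the terms `cs`, computed from `com cs`. -/
def comArity : Tm (DPSym F D) V → ℕ
  | .var _ => 1
  | .func f _ => DPSym.comArity f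

/-- Makes the number of children a function of the rule alone, hence bounded on a finite set of
pairs. For a single child this needs that leaves have no compound root. -/
theorem comArity_com_map_mark (rs : List (Tm F V)) :
    comArity (com (rs.map (mark D))) = rs.length := by
  rcases com_eq_func (rs.map (mark D)) with ⟨c, hc⟩ | hc
  · obtain ⟨r, rfl, rfl⟩ := List.map_eq_singleton_iff.1 hc
    have : ∀ s : Tm (DPSym F D) V, Leaf D s → comArity s = 1 := by
      rintro s (⟨t, rfl⟩ | ⟨n, f, hf, ts, rfl⟩)
      · cases t <;> simp [comArity, embed, DPSym.comArity]
      · simp [comArity, DPSym.comArity]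
    exact this _ (leaf_mark r)
  · rw [hc]
    simp [comArity, DPSym.comArity]

end Compound

/-! ### Dependency graph and derivations that use only lower pairs -/

section Decomposition

variable {F : ℕ → Type u} {V : Type v} {D : ∀ n, Set (F n)}

theorem embedTRS_union (R R' : Set (Rule F V)) :
    embedTRS D (R ∪ R') = embedTRS D R ∪ embedTRS D R' :=
  Set.image_union _ _ _

theorem embedTRS_mono {R R' : Set (Rule F V)} (h : R ⊆ R') : embedTRS D R ⊆ embedTRS D R' :=
  Set.image_mono h

namespace DPProblem

variable (P : DPProblem F D V)

theorem isDP {ρ : Rule (DPSym F D) V} (h : ρ ∈ P.strictDP ∪ P.weakDP) : IsDP ρ :=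
  h.elim (P.isDP_strict ρ) (P.isDP_weak ρ)

theorem isRewriteRule {ρ : Rule F V} (h : ρ ∈ P.strictTRS ∪ P.weakTRS) : ρ.IsRewriteRule :=
  h.elim (P.isTRS_strict.2 ρ) (P.isTRS_weak.2 ρ)

/-- `s` rewrites by rules over `F` to an instance of the left-hand side of `ρ`. -/
def Reaches (s : Tm (DPSym F D) V) (ρ : Rule (DPSym F D) V) : Prop :=
  ∃ τ : V → Tm F V, Relation.ReflTransGen (QRew P.Q (embedTRS D (P.strictTRS ∪ P.weakTRS))) s
    (ρ.lhs.subst fun x => embed D (τ x))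

variable {P}

theorem Reaches.head {s t : Tm (DPSym F D) V} {ρ : Rule (DPSym F D) V} {R : Set (Rule F V)}
    (hR : R ⊆ P.strictTRS ∪ P.weakTRS) (h : Step (NF P.Q) (embedTRS D R) s t)
    (ht : P.Reaches t ρ) : P.Reaches s ρ :=
  let ⟨τ, hτ⟩ := ht; ⟨τ, .head (h.mono (embedTRS_mono hR)) hτ⟩

theorem dgArrow_of_reaches {l r : Tm F V} {rs : List (Tm F V)} {ρ : Rule (DPSym F D) V}
    {τ : V → Tm F V} (h : dpRule D l rs ∈ P.strictDP ∪ P.weakDP) (hr : r ∈ rs)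
    (hρ : ρ ∈ P.strictDP ∪ P.weakDP)
    (hc : P.Reaches ((mark D r).subst fun x => embed D (τ x)) ρ) :
    P.DGArrow (dpRule D l rs) ρ :=
  let ⟨τ', h'⟩ := hc; ⟨h, hρ, l, rs, r, rfl, hr, τ, τ', h'⟩

theorem strict_union_weak_subset (A B : Set (Rule (DPSym F D) V)) :
    (P.withPairs A B).strict ∪ (P.withPairs A B).weak =
      (A ∪ B) ∪ embedTRS D (P.strictTRS ∪ P.weakTRS) := by
  simp only [withPairs, embedTRS_union]
  exact Set.union_union_union_comm _ _ _ _

theorem compoundFree_toProblem :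
    CompoundFree (P.toProblem.strict ∪ P.toProblem.weak) := by
  rw [toProblem, strict_union_weak_subset]
  exact compoundFree_union_embedTRS (fun ρ => P.isDP) _

variable {A B E : Set (Rule (DPSym F D) V)}

/-- A first step of a problem from a leaf, with `δ` recording whether it is counted, is a step with
a rule over `F` or a root step with a dependency pair. -/
theorem der_cases_leaf {l k : ℕ} {s u : Tm (DPSym F D) V} (hs : Leaf D s)
    (h : Der (NF P.Q) P.toProblem.strict P.toProblem.weak l k s u) :
    k = 0 ∨ ∃ l' k' δ t, l = l' + 1 ∧ k = k' + δ ∧ δ ≤ 1 ∧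
      Der (NF P.Q) P.toProblem.strict P.toProblem.weak l' k' t u ∧
      ((Leaf D t ∧ Step (NF P.Q) (embedTRS D (P.strictTRS ∪ P.weakTRS)) s t ∧
          (δ = 1 → Step (NF P.Q) (embedTRS D P.strictTRS) s t)) ∨
        ∃ (l : Tm F V) (rs : List (Tm F V)) (τ : V → Tm F V),
          dpRule D l rs ∈ P.strictDP ∪ P.weakDP ∧ (δ = 1 → dpRule D l rs ∈ P.strictDP) ∧
          s = (mark D l).subst (fun x => embed D (τ x)) ∧
          t = com (rs.map fun r => (mark D r).subst fun x => embed D (τ x)) ∧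
          ∀ (rs' : List (Tm F V)) (A : Set (Rule (DPSym F D) V)), dpRule D l rs' ∈ A →
            Step (NF P.Q) A s
              (com (rs'.map fun r => (mark D r).subst fun x => embed D (τ x)))) := by
  cases h with
  | refl => exact .inl rfl
  | @strict l k _ t _ h hd =>
    refine .inr ⟨l, k, 1, t, rfl, rfl, le_rfl, hd, ?_⟩
    rcases hs.step P.isDP_strict P.isTRS_strict.2 h with ⟨h1, h2⟩ | ⟨l, rs, τ, h1, h2⟩
    · exact .inl ⟨h2, h1.mono (embedTRS_mono Set.subset_union_left), fun _ => h1⟩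
    · exact .inr ⟨l, rs, τ, .inl h1, fun _ => h1, h2⟩
  | @weak l k _ t _ h hd =>
    refine .inr ⟨l, k, 0, t, rfl, rfl, zero_le_one, hd, ?_⟩
    rw [toProblem, strict_union_weak_subset] at h
    rcases hs.step (fun _ => P.isDP) (fun _ => P.isRewriteRule) h with
      ⟨h1, h2⟩ | ⟨l, rs, τ, h1, h2⟩
    · exact .inl ⟨h2, h1, by simp⟩
    · exact .inr ⟨l, rs, τ, h1, by simp, h2⟩

/-- Rules of `S` are strict in every problem `withPairs A B`, so the count `δ` carries over. -/
theorem run_embed_step {k δ : ℕ} (hδ : δ ≤ 1) {s t : Tm (DPSym F D) V}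
    (h : Step (NF P.Q) (embedTRS D (P.strictTRS ∪ P.weakTRS)) s t)
    (h' : δ = 1 → Step (NF P.Q) (embedTRS D P.strictTRS) s t)
    (hr : Run (NF P.Q) (P.withPairs A B).strict (P.withPairs A B).weak k t) :
    Run (NF P.Q) (P.withPairs A B).strict (P.withPairs A B).weak (k + δ) s := by
  interval_cases δ
  · refine .weak ?_ hr
    rw [strict_union_weak_subset]
    exact h.mono Set.subset_union_right
  · exact .strict ((h' rfl).mono Set.subset_union_right) hr

theorem run_dp_step {k δ : ℕ} (hδ : δ ≤ 1) {l : Tm F V} {rs : List (Tm F V)} {τ : V → Tm F V}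
    {s : Tm (DPSym F D) V} (h : dpRule D l rs ∈ A ∪ B) (h' : δ = 1 → dpRule D l rs ∈ A)
    (hstep : ∀ (rs' : List (Tm F V)) (A : Set (Rule (DPSym F D) V)), dpRule D l rs' ∈ A →
      Step (NF P.Q) A s (com (rs'.map fun r => (mark D r).subst fun x => embed D (τ x))))
    (hr : Run (NF P.Q) (P.withPairs A B).strict (P.withPairs A B).weak k
      (com (rs.map fun r => (mark D r).subst fun x => embed D (τ x)))) :
    Run (NF P.Q) (P.withPairs A B).strict (P.withPairs A B).weak (k + δ) s := by
  interval_cases δ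
  · refine .weak ?_ hr
    rw [strict_union_weak_subset]
    exact hstep rs _ (.inl h)
  · exact .strict (hstep rs _ (.inl (h' rfl))) hr

/-- A derivation from a leaf from which only pairs of a successor closed set are reachable uses only
pairs of this set. -/
theorem run_of_reaches_closed (hAB : P.ClosedUnderSucc (A ∪ B))
    (hA : P.strictDP ∩ (A ∪ B) ⊆ A) {l k : ℕ} {s u : Tm (DPSym F D) V} (hs : Leaf D s)
    (hlow : ∀ ρ ∈ P.strictDP ∪ P.weakDP, P.Reaches s ρ → ρ ∈ A ∪ B)
    (h : Der (NF P.Q) P.toProblem.strict P.toProblem.weak l k s u) :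
    Run (NF P.Q) (P.withPairs A (B ∪ E)).strict (P.withPairs A (B ∪ E)).weak k s := by
  induction l using Nat.strong_induction_on generalizing k s u with
  | _ l ih =>
  rcases der_cases_leaf hs h with rfl | ⟨l', k', δ, t, rfl, rfl, hδ, hd,
    ⟨ht, hst, hst'⟩ | ⟨lt, rs, τ, hρ, hρ', hst, rfl, hstep⟩⟩
  · exact .zero s
  · exact run_embed_step hδ hst hst'
      (ih l' (by omega) ht (fun ρ hρ hr => hlow ρ hρ (hr.head subset_rfl hst)) hd)
  -- The redex is itself an instance of the left-hand side, so the pair is reached in zero steps.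
  · have hmem : dpRule D lt rs ∈ A ∪ B := hlow _ hρ ⟨τ, hst ▸ .refl⟩
    refine run_dp_step hδ (hmem.imp id .inl) (fun h => hA ⟨hρ' h, hmem⟩) hstep ?_
    obtain ⟨k'', rfl, hk⟩ := hd.split_com compoundFree_toProblem
    refine .com _ _ fun i => ?_
    obtain ⟨l'', hl, u', hd'⟩ := hk i
    obtain ⟨r, hr, he⟩ := List.mem_map.1 (List.get_mem _ i)
    rw [← he] at hd' ⊢
    exact ih l'' (by omega) ((leaf_mark r).subst τ)
      (fun ρ hρ2 hre => hAB _ hmem _ (dgArrow_of_reaches hρ hr hρ2 hre)) hd'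

end DPProblem

end Decomposition

/-! ### Charging lower derivations to strict upper steps -/

namespace DPProblem

variable {F : ℕ → Type u} {V : Type v} {D : ∀ n, Set (F n)} {P : DPProblem F D V}

/-- A derivation from a leaf decomposes into an upper derivation and at most `K` lower derivations
per counted upper step, plus one if a lower pair is reachable without using upper pairs. -/
theorem exists_upper_run {Sdown Sup Wdown Wup : Set (Rule (DPSym F D) V)}
    (hS : Sdown ∪ Sup = P.strictDP) (hW : Wdown ∪ Wup = P.weakDP)
    (hSW : Disjoint Sup Wdown)
    (hclosed : P.ClosedUnderSucc (Sdown ∪ Wdown))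
    (hpre : P.Pre (Sdown ∪ Wdown) \ (Sdown ∪ Wdown) ⊆ Sup) {K : ℕ}
    (hK : ∀ l rs, dpRule D l rs ∈ Sup → rs.length ≤ K) {b : ℕ} {t₀ : Tm (DPSym F D) V}
    (hb : ∀ k, Run (NF P.Q) (P.withPairs Sdown (Wdown ∪ sep (Sup ∪ Wup))).strict
      (P.withPairs Sdown (Wdown ∪ sep (Sup ∪ Wup))).weak k t₀ → k ≤ b)
    {l k ε : ℕ} {s u : Tm (DPSym F D) V} (hs : Leaf D s)
    (hpath : Relation.ReflTransGen
      (Step (NF P.Q) (sep (Sup ∪ Wup) ∪ embedTRS D (P.strictTRS ∪ P.weakTRS))) t₀ s)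
    (hε : ε = 1 ∨ ∀ ρ ∈ P.strictDP ∪ P.weakDP, P.Reaches s ρ → ρ ∉ Sdown ∪ Wdown)
    (h : Der (NF P.Q) P.toProblem.strict P.toProblem.weak l k s u) :
    ∃ a, Run (NF P.Q) (P.withPairs Sup Wup).strict (P.withPairs Sup Wup).weak a s ∧
      k ≤ a + (K * a + ε) * b := by
  -- Strict and weak pairs may overlap. Disjointness of `Sup` and `Wdown` ensures that a counted
  -- lower pair is also counted in the lower problem.
  have hstrict : P.strictDP ∩ (Sdown ∪ Wdown) ⊆ Sdown := by
    rintro ρ ⟨h1, h2 | h2⟩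
    · exact h2
    · rw [← hS] at h1
      exact h1.resolve_right fun h => Set.disjoint_left.1 hSW h h2
  induction l using Nat.strong_induction_on generalizing k s u ε with
  | _ l ih =>
  rcases der_cases_leaf hs h with rfl | ⟨l', k', δ, t, rfl, rfl, hδ, hd,
    ⟨ht, hst, hst'⟩ | ⟨lt, rs, τ, hρ, hρ', hst, rfl, hstep⟩⟩
  · exact ⟨0, .zero s, Nat.zero_le _⟩
  · obtain ⟨a, ha, hk⟩ := ih l' (by omega) ht
      (hpath.tail (hst.mono Set.subset_union_right))
      (hε.imp id fun h ρ hρ hr => h ρ hρ (hr.head subset_rfl hst)) hd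
    refine ⟨a + δ, run_embed_step hδ hst hst' ha, ?_⟩
    have : (K * a + ε) * b ≤ (K * (a + δ) + ε) * b := by gcongr; omega
    omega
  obtain ⟨k'', rfl, hk⟩ := hd.split_com compoundFree_toProblem
  by_cases hmem : dpRule D lt rs ∈ Sdown ∪ Wdown
  · obtain rfl : ε = 1 := hε.resolve_right fun h => h _ hρ ⟨τ, hst ▸ .refl⟩ hmem
    -- The branch is cut here: the upper run is empty and all remaining steps are charged to one
    -- lower derivation.
    refine ⟨0, .zero s, ?_⟩
    have := hb (∑ i, k'' i + δ) ?_
    · simpa using this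
    -- `hb` bounds only runs from `t₀`, so the path to `s` is put in front, with all its steps
    -- uncounted.
    refine Run.of_reflTransGen (Relation.ReflTransGen.mono (fun _ _ h => ?_) _ _ hpath)
      (run_dp_step hδ (hmem.imp id .inl) (fun h => hstrict ⟨hρ' h, hmem⟩) hstep
        (.com _ _ fun i => ?_))
    · rw [strict_union_weak_subset]
      exact h.mono (Set.union_subset_union_left _ fun _ h => .inr (.inr h))
    · obtain ⟨l'', hl, u', hd'⟩ := hk i
      obtain ⟨r, hr, he⟩ := List.mem_map.1 (List.get_mem _ i)
      rw [← he] at hd' ⊢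
      exact run_of_reaches_closed hclosed hstrict ((leaf_mark r).subst τ)
        (fun ρ hρ2 hre => hclosed _ hmem _ (dgArrow_of_reaches hρ hr hρ2 hre)) hd'
  have hup : dpRule D lt rs ∈ Sup ∪ Wup := by
    rw [← hS, ← hW] at hρ
    rcases hρ with (h | h) | (h | h)
    exacts [(hmem (.inl h)).elim, .inl h, (hmem (.inr h)).elim, .inr h]
  have hδSup : δ = 1 → dpRule D lt rs ∈ Sup := fun h =>
    (hS.symm ▸ hρ' h : dpRule D lt rs ∈ Sdown ∪ Sup).resolve_left fun h => hmem (.inl h)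
  -- If the pair is not in `Sup`, then `hpre` excludes lower pairs as its successors, and its
  -- children need no lower derivation before the next pair in `Sup`.
  have children : ∀ ε', (ε' = 1 ∨ dpRule D lt rs ∉ Sup) →
      ∀ i, ∃ a, Run (NF P.Q) (P.withPairs Sup Wup).strict (P.withPairs Sup Wup).weak a
        ((rs.map fun r => (mark D r).subst fun x => embed D (τ x)).get i) ∧
        k'' i ≤ a + (K * a + ε') * b := by
    intro ε' hε' i
    obtain ⟨l'', hl, u', hd'⟩ := hk i
    obtain ⟨r, hr, he⟩ := List.mem_map.1 (List.get_mem _ i)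
    rw [← he] at hd' ⊢
    refine ih l'' (by omega) ((leaf_mark r).subst τ) (hpath.tail ?_)
      (hε'.imp id fun h ρ hρ2 hre hρ3 => h (hpre
        ⟨⟨ρ, hρ3, dgArrow_of_reaches hρ hr hρ2 hre⟩, hmem⟩)) hd'
    exact hstep [r] _ (.inl ⟨lt, rs, r, hup, hr, rfl⟩)
  by_cases hSup : dpRule D lt rs ∈ Sup
  · choose a ha hka using children 1 (.inl rfl)
    -- The upper run counts this step even if `δ = 0`: the resulting `K` additional lower
    -- derivations pay for the at most `K` children.
    refine ⟨∑ i, a i + 1, run_dp_step le_rfl hup (fun _ => hSup) hstep (.com _ _ ha), ?_⟩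
    have hsum := Finset.sum_le_sum fun i (_ : i ∈ Finset.univ) => hka i
    rw [Finset.sum_add_distrib, ← Finset.sum_mul, Finset.sum_add_distrib, ← Finset.mul_sum] at hsum
    simp only [Finset.sum_const, Finset.card_univ, Fintype.card_fin, List.length_map,
      smul_eq_mul, mul_one] at hsum
    have : (K * ∑ i, a i + rs.length) * b ≤ (K * (∑ i, a i + 1) + ε) * b := by
      have := hK _ _ hSup
      refine Nat.mul_le_mul_right b ?_
      rw [mul_add]
      omega
    omega
  · choose a ha hka using children 0 (.inr hSup)
    obtain rfl : δ = 0 := by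
      by_contra h0
      exact hSup (hδSup (by omega))
    refine ⟨∑ i, a i, run_dp_step hδ hup hδSup hstep (.com _ _ ha), ?_⟩
    have hsum := Finset.sum_le_sum fun i (_ : i ∈ Finset.univ) => hka i
    rw [Finset.sum_add_distrib, ← Finset.sum_mul, Finset.sum_add_distrib, ← Finset.mul_sum] at hsum
    simp only [Finset.sum_const_zero, add_zero] at hsum
    have : (K * ∑ i, a i) * b ≤ (K * ∑ i, a i + ε) * b := by gcongr; omega
    omega

end DPProblem

end CombFramework

/-! ### The asymptotic bound -/

open CombFramework
theorem mainTheorem1 {F : ℕ → Type*} {V : Type*} [Countable V] [Infinite V]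
    (D : ∀ n, Set (F n)) (P : DPProblem F D V)
    (Sdown Sup Wdown Wup : Set (Rule (DPSym F D) V))
    (hS : Sdown ∪ Sup = P.strictDP) (hS_disj : Disjoint Sdown Sup)
    (hW : Wdown ∪ Wup = P.weakDP) (hW_disj : Disjoint Wdown Wup)
    (hSW : Disjoint Sup Wdown)
    (hclosed : P.ClosedUnderSucc (Sdown ∪ Wdown))
    (hpre : P.Pre (Sdown ∪ Wdown) \ (Sdown ∪ Wdown) ⊆ Sup)
    (f g : ℕ → ℕ)
    (hf : ∀ᶠ n in Filter.atTop, 1 ≤ f n) (hg : ∀ᶠ n in Filter.atTop, 1 ≤ g n)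
    (hup : (P.withPairs Sup Wup).Valid f)
    (hdown : (P.withPairs Sdown (Wdown ∪ sep (Sup ∪ Wup))).Valid g) :
    P.toProblem.Valid (fun n => f n * g n) := by
  obtain ⟨K, hK⟩ : ∃ K, ∀ l rs, dpRule D l rs ∈ Sup → rs.length ≤ K := by
    have hfin : Sup.Finite := P.strictDP_finite.subset (hS ▸ Set.subset_union_right)
    obtain ⟨K, hK⟩ := (hfin.image fun ρ => comArity ρ.rhs).bddAbove
    exact ⟨K, fun l rs h => by
      simpa [dpRule, comArity_com_map_mark] using hK (Set.mem_image_of_mem _ h)⟩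
  -- Validity makes both complexities finite, so `toNat` loses nothing.
  set a : ℕ → ℕ := fun n => ((P.withPairs Sup Wup).complexity n).toNat
  set b : ℕ → ℕ := fun n =>
    ((P.withPairs Sdown (Wdown ∪ sep (Sup ∪ Wup))).complexity n).toNat
  have key : ∀ n, P.toProblem.complexity n ≤ ((a n + (K * a n + 1) * b n : ℕ) : ℕ∞) := by
    intro n
    rw [Problem.complexity_le_iff]
    rintro t ht hn k ⟨l, u, hd⟩
    have hup' := (Problem.complexity_le_iff (P.withPairs Sup Wup) n _).1
      (ENat.natCast_toNat (hup.1 n)).ge t ht hn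
    have hdown' := (Problem.complexity_le_iff
      (P.withPairs Sdown (Wdown ∪ sep (Sup ∪ Wup))) n _).1
      (ENat.natCast_toNat (hdown.1 n)).ge t ht hn
    obtain ⟨s, -, rfl⟩ := P.start_basic t ht
    obtain ⟨a', ha', hk⟩ := DPProblem.exists_upper_run (ε := 1) hS hW hSW hclosed hpre hK
      (fun k hk => Nat.cast_le.1 (hdown' k hk)) (leaf_mark s) .refl (.inl rfl) hd
    have haa : a' ≤ a n := Nat.cast_le.1 (hup' a' ha')
    refine Nat.cast_le.2 (hk.trans ?_)
    gcongr
  refine ⟨fun n => ne_top_of_le_ne_top (ENat.natCast_ne_top _) (key n), ?_⟩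
  -- The lower bounds on `f` and `g` absorb the `1` in `K * a n + 1` and the summand `a n` without a
  -- factor `b n`, respectively.
  have h1f : (fun _ => (1 : ℝ)) =O[Filter.atTop] fun n => (f n : ℝ) :=
    .of_bound 1 (hf.mono fun n hn => by simpa using hn)
  have h1g : (fun _ => (1 : ℝ)) =O[Filter.atTop] fun n => (g n : ℝ) :=
    .of_bound 1 (hg.mono fun n hn => by simpa using hn)
  have hsum : (fun n => ((a n + (K * a n + 1) * b n : ℕ) : ℝ))
      =O[Filter.atTop] fun n => ((f n * g n : ℕ) : ℝ) := by
    push_cast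
    refine .add (by simpa using hup.2.mul h1g) (.mul ?_ hdown.2)
    exact (hup.2.const_mul_left _).add h1f
  refine .trans (.of_bound 1 (.of_forall fun n => ?_)) hsum
  have := ENat.toNat_le_of_le_natCast (key n)
  rw [one_mul, Real.norm_natCast, Real.norm_natCast]
  exact Nat.cast_le.2 this
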